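/- Let $\lambda_1,\lambda_2\in\mathbb C$ with $|\lambda_1|,|\lambda_2|<1$, and let \[ A=\begin{bmatrix}0 & \sqrt{1-|\lambda_1|^2} & -\overline{\lambda_1}\sqrt{1-|\lambda_2|^2}\\ 0 & \lambda_1 & \sqrt{1-|\lambda_1|^2}\sqrt{1-|\lambda_2|^2}\\ 0 & 0 & \lambda_2\end{bmatrix}, \] a partial isometry of rank two with eigenvalues $0,\lambda_1,\lambda_2$. Let $W(A)=\{\langle Ax,x\rangle : x\in\mathbb C^3,\ \|x\|=1\}$ be its numerical range. Then: (i) if $\lambda_1=-\lambda_2$, then $W(A)$ is a (non-degenerate, closed) elliptical disk with foci $\lambda_1,\lambda_2$; (ii) if $\lambda_1=\lambda_2$, then $W(A)$ is a (non-degenerate, closed) elliptical disk with foci $0$ and $\lambda_1$; (iii) if $\lambda_1\neq\pm\lambda_2$, then $W(A)$ has an ovular shape, that is, it is a compact convex set with non-empty interior, its boundary is smooth (there is exactly one supporting line at each boundary point) and contains no non-degenerate line segment, and it is not an elliptical disk (for any choice of foci). (An elliptical disk with coinciding foci is a circular disk.) -/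

import Mathlib

open scoped ComplexConjugate

/-- The numerical range `W(A) = {⟨Ax, x⟩ : ‖x‖ = 1}` of a complex matrix
(Mathlib's inner product is conjugate-linear in its first argument). -/
def numericalRange {n : ℕ} (A : Matrix (Fin n) (Fin n) ℂ) : Set ℂ :=
  {w : ℂ | ∃ x : EuclideanSpace ℂ (Fin n), ‖x‖ = 1 ∧ w = inner ℂ x (Matrix.toEuclideanLin A x)}

/-- The 3-by-3 rank-two partial isometry in upper triangular form
with eigenvalues `0, μ₁, μ₂` in the open unit disk. -/
noncomputable def rankTwoPartialIsometry (μ₁ μ₂ : ℂ) : Matrix (Fin 3) (Fin 3) ℂ :=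
  !![0, (√(1 - ‖μ₁‖ ^ 2) : ℝ), -conj μ₁ * (√(1 - ‖μ₂‖ ^ 2) : ℝ);
     0, μ₁, (√(1 - ‖μ₁‖ ^ 2) : ℝ) * (√(1 - ‖μ₂‖ ^ 2) : ℝ);
     0, 0, μ₂]

/-- `K` is a (closed, non-degenerate) elliptical disk with foci `f₁` and `f₂`;
it is a circular disk when `f₁ = f₂`. -/
def IsEllipticalDisk (K : Set ℂ) (f₁ f₂ : ℂ) : Prop :=
  ∃ r : ℝ, dist f₁ f₂ < r ∧ K = {z : ℂ | dist z f₁ + dist z f₂ ≤ r}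

/-- The boundary of `K` contains a flat portion, that is, a non-degenerate line segment. -/
def HasFlatPortion (K : Set ℂ) : Prop :=
  ∃ p q : ℂ, p ≠ q ∧ segment ℝ p q ⊆ frontier K

/-- The boundary of `K` has no corners: through each boundary point there is exactly one
supporting line (recorded by its outer unit normal `u`). -/
def HasSmoothBoundary (K : Set ℂ) : Prop :=
  ∀ p ∈ frontier K, ∃! u : ℂ, ‖u‖ = 1 ∧ ∀ z ∈ K, inner ℝ u z ≤ inner ℝ u p

/-- `K` is of ovular shape: a planar convex body whose boundary is smooth and has no flat
portions, and which is not an elliptical disk. -/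
structure IsOvular (K : Set ℂ) : Prop where
  isCompact : IsCompact K
  convex : Convex ℝ K
  nonempty_interior : (interior K).Nonempty
  smooth : HasSmoothBoundary K
  not_flat : ¬ HasFlatPortion K
  not_elliptical : ∀ f₁ f₂ : ℂ, ¬ IsEllipticalDisk K f₁ f₂

/-!
For a unit direction `u`, the support value of `W(A)` is the largest `t` for which the Hermitian
matrix `P(u, t) = 2t - (ū A + u Aᴴ)` is singular, so `W(A)` is determined by the cubic polynomial
`det P(u, t)` in `t` (Kippenhahn). With `α = ⟪u, μ₁⟫` and `β = ⟪u, μ₂⟫`, this cubic vanishes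
exactly when `t (t - α) (t - β) = ((1 - |μ₂|²) (t - α) + (1 - |μ₁|²) (t - β)) / 4`.

The product of the distances of the two foci of an ellipse to a tangent line is constant, so the
support values of an ellipse with foci `f₁`, `f₂` are the larger roots of
`(t - ⟪u, f₁⟫) (t - ⟪u, f₂⟫) = b`. If `μ₁ = ± μ₂`, the cubic is the product of such a quadratic and
a factor `t - ⟪u, g⟫` with `g` between the foci. Conversely, if `W(A)` is an ellipse, then the
third root of the cubic is `⟪u, w⟫` with `w = μ₁ + μ₂ - f₁ - f₂`. Substituting it gives an equality
on the unit circle between a product of three linear forms and a linear form, which forces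
`w (w - μ₁) (w - μ₂) = 0`, then the linear form to vanish, and finally `μ₁ = ± μ₂`.

Two supporting lines through the same boundary point produce a common eigenvector of `A` and `Aᴴ`
(Donoghue), and a flat portion of the boundary produces a singular `P(u, t)` of corank at least
two. Neither occurs: `A` has no one-dimensional reducing subspace, and a vector in the kernel of
`P(u, t)` is determined by its first coordinate.
-/

section ConvexBodies

variable {V : Type*} [NormedAddCommGroup V] [InnerProductSpace ℝ V]

theorem exists_unit_eq_mul_inner [CompleteSpace V] {f : StrongDual ℝ V} (hf : f ≠ 0) :
    ∃ u : V, ‖u‖ = 1 ∧ ∃ c : ℝ, 0 < c ∧ ∀ z, f z = c * inner ℝ u z := by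
  obtain ⟨v, rfl⟩ := (InnerProductSpace.toDual ℝ V).surjective f
  have hv : v ≠ 0 := by
    rintro rfl
    simp at hf
  have hv_norm : 0 < ‖v‖ := norm_pos_iff.2 hv
  refine ⟨‖v‖⁻¹ • v, norm_smul_inv_norm (𝕜 := ℝ) hv, ‖v‖, hv_norm, fun z => ?_⟩
  rw [real_inner_smul_left, mul_inv_cancel_left₀ hv_norm.ne', InnerProductSpace.toDual_apply_apply]

theorem eq_zero_of_forall_unit_inner_eq_zero {v : V}
    (h : ∀ u : V, ‖u‖ = 1 → inner ℝ u v = 0) : v = 0 := by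
  by_contra hv
  have := h (‖v‖⁻¹ • v) (norm_smul_inv_norm (𝕜 := ℝ) hv)
  rw [real_inner_smul_left, real_inner_self_eq_norm_sq] at this
  simp [hv] at this

theorem eq_setOf_forall_unit_inner_le_of_isGreatest [CompleteSpace V] {K : Set V}
    (hK : IsClosed K) (hconv : Convex ℝ K) (hne : K.Nonempty) {h : V → ℝ}
    (hgreatest : ∀ u, ‖u‖ = 1 → IsGreatest ((fun z => inner ℝ u z) '' K) (h u)) :
    K = {z | ∀ u, ‖u‖ = 1 → inner ℝ u z ≤ h u} := by
  refine Set.Subset.antisymm (fun z hz u hu => (hgreatest u hu).2 ⟨z, hz, rfl⟩) fun z hz => ?_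
  by_contra hzK
  obtain ⟨f, s, hfK, hfz⟩ := geometric_hahn_banach_closed_point hconv hK hzK
  have hf : f ≠ 0 := by
    rintro rfl
    obtain ⟨k, hk⟩ := hne
    exact absurd (hfK k hk) hfz.not_gt
  obtain ⟨u, hu, c, hc, hfu⟩ := exists_unit_eq_mul_inner hf
  obtain ⟨k, hk, hku⟩ := (hgreatest u hu).1
  have hlt : f k < f z := (hfK k hk).trans hfz
  rw [hfu, hfu, mul_lt_mul_iff_right₀ hc] at hlt
  exact absurd (hz u hu) (hku.symm.trans_lt hlt).not_ge

theorem exists_unit_inner_eq_of_interior_eq_empty [FiniteDimensional ℝ V] {K : Set V}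
    (hconv : Convex ℝ K) (hne : K.Nonempty) (hint : interior K = ∅) :
    ∃ u : V, ‖u‖ = 1 ∧ ∃ t, ∀ z ∈ K, inner ℝ u z = t := by
  obtain ⟨k, hk⟩ := hne
  have hk_span : k ∈ affineSpan ℝ K := subset_affineSpan ℝ K hk
  have hspan : (affineSpan ℝ K).direction ≠ ⊤ := by
    rw [Ne, AffineSubspace.direction_eq_top_iff_of_nonempty ⟨k, hk_span⟩,
      ← hconv.interior_nonempty_iff_affineSpan_eq_top, hint]
    exact Set.not_nonempty_empty
  obtain ⟨v, hv, hv0⟩ := Submodule.exists_mem_ne_zero_of_ne_bot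
    (mt Submodule.orthogonal_eq_bot_iff.1 hspan)
  refine ⟨‖v‖⁻¹ • v, norm_smul_inv_norm (𝕜 := ℝ) hv0, ‖v‖⁻¹ * inner ℝ v k, fun z hz => ?_⟩
  have hvz : inner ℝ v (z - k) = 0 := Submodule.inner_left_of_mem_orthogonal
    (AffineSubspace.vsub_mem_direction (subset_affineSpan ℝ K hz) hk_span) hv
  rw [real_inner_smul_left, sub_eq_zero.1 ((inner_sub_right v z k).symm.trans hvz)]

theorem exists_unit_supporting_normal [FiniteDimensional ℝ V] {K : Set V}
    (hconv : Convex ℝ K) {p : V} (hp : p ∈ K) (hp_int : p ∉ interior K) :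
    ∃ u : V, ‖u‖ = 1 ∧ ∀ z ∈ K, inner ℝ u z ≤ inner ℝ u p := by
  rcases (interior K).eq_empty_or_nonempty with hint | hint
  · obtain ⟨u, hu, t, ht⟩ := exists_unit_inner_eq_of_interior_eq_empty hconv ⟨p, hp⟩ hint
    exact ⟨u, hu, fun z hz => ((ht z hz).trans (ht p hp).symm).le⟩
  · obtain ⟨f, hf, hfp⟩ := geometric_hahn_banach_of_nonempty_interior_point hconv hp_int hint
    obtain ⟨u, hu, c, hc, hfu⟩ := exists_unit_eq_mul_inner hf
    refine ⟨u, hu, fun z hz => ?_⟩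
    have := hfp z hz
    rwa [hfu, hfu, mul_le_mul_iff_right₀ hc] at this

end ConvexBodies

section EllipticalDisks

variable {V : Type*} [NormedAddCommGroup V] [InnerProductSpace ℝ V]

/-- The mirror image of `f` in the hyperplane `{z | ⟪u, z⟫ = h}` with unit normal `u`, used to
unfold a path from one focus of an ellipse to the other at a tangent line. -/
def mirrorImage (u : V) (h : ℝ) (f : V) : V :=
  f + (2 * (h - inner ℝ u f)) • u

theorem inner_mirrorImage {u : V} (hu : ‖u‖ = 1) (h : ℝ) (f : V) :
    inner ℝ u (mirrorImage u h f) = 2 * h - inner ℝ u f := by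
  rw [mirrorImage, inner_add_right, real_inner_smul_right, real_inner_self_eq_norm_sq, hu]
  ring

theorem dist_mirrorImage_sq {u : V} (hu : ‖u‖ = 1) (h : ℝ) (f z : V) :
    dist z (mirrorImage u h f) ^ 2 =
      dist z f ^ 2 + 4 * ((h - inner ℝ u f) * (h - inner ℝ u z)) := by
  rw [dist_eq_norm, dist_eq_norm, mirrorImage, ← sub_sub, norm_sub_sq_real, norm_smul, hu,
    real_inner_smul_right, inner_sub_left, real_inner_comm u z, real_inner_comm u f, mul_one,
    Real.norm_eq_abs, sq_abs]
  ring

-- A line is tangent to an ellipse when the product of its distances to the foci is the square of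
-- the minor semi-axis.
theorem isGreatest_inner_image_setOf_dist_add_dist_le {f₁ f₂ u : V} {h r : ℝ} (hu : ‖u‖ = 1)
    (hr : 0 ≤ r) (h₁ : inner ℝ u f₁ < h) (h₂ : inner ℝ u f₂ < h)
    (htangent : 4 * ((h - inner ℝ u f₁) * (h - inner ℝ u f₂)) = r ^ 2 - dist f₁ f₂ ^ 2) :
    IsGreatest ((fun z => inner ℝ u z) '' {z | dist z f₁ + dist z f₂ ≤ r}) h := by
  have hr_eq : dist f₂ (mirrorImage u h f₁) = r := by
    rw [← sq_eq_sq₀ dist_nonneg hr, dist_mirrorImage_sq hu, htangent, dist_comm]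
    ring
  constructor
  · obtain ⟨z, hz, hzh⟩ : h ∈ innerₗ V u '' segment ℝ f₂ (mirrorImage u h f₁) := by
      have himage := image_segment ℝ (innerₗ V u).toAffineMap f₂ (mirrorImage u h f₁)
      rw [LinearMap.coe_toAffineMap, innerₗ_apply_apply, innerₗ_apply_apply, inner_mirrorImage hu,
        segment_eq_Icc (by linarith)] at himage
      exact himage ▸ ⟨h₂.le, by linarith⟩
    rw [innerₗ_apply_apply] at hzh
    have hz_mirror : dist z (mirrorImage u h f₁) = dist z f₁ := by
      rw [← sq_eq_sq₀ dist_nonneg dist_nonneg, dist_mirrorImage_sq hu, hzh, sub_self]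
      ring
    refine ⟨z, ?_, hzh⟩
    rw [Set.mem_ofPred_eq, ← hr_eq, ← dist_add_dist_of_mem_segment hz, hz_mirror, dist_comm z f₂,
      add_comm]
  · rintro _ ⟨z, hz, rfl⟩
    by_contra! hzh
    have hz_mirror : dist z (mirrorImage u h f₁) < dist z f₁ := by
      rw [← sq_lt_sq₀ dist_nonneg dist_nonneg, dist_mirrorImage_sq hu]
      nlinarith
    have htri := dist_triangle_left f₂ (mirrorImage u h f₁) z
    rw [Set.mem_ofPred_eq] at hz
    linarith

theorem exists_lt_sub_mul_sub_eq (α β : ℝ) {b : ℝ} (hb : 0 < b) :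
    ∃ h, α < h ∧ β < h ∧ (h - α) * (h - β) = b := by
  have hsq := Real.sq_sqrt (show 0 ≤ (α - β) ^ 2 + 4 * b by positivity)
  have hlt := Real.lt_sqrt_of_sq_lt (x := |α - β|) (y := (α - β) ^ 2 + 4 * b)
    (by rw [sq_abs]; linarith)
  obtain ⟨hlt₁, hlt₂⟩ := abs_lt.1 hlt
  refine ⟨(α + β + √((α - β) ^ 2 + 4 * b)) / 2, by linarith, by linarith, ?_⟩
  linear_combination hsq / 4

theorem isClosed_setOf_dist_add_dist_le {X : Type*} [PseudoMetricSpace X] (f₁ f₂ : X) (r : ℝ) :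
    IsClosed {z | dist z f₁ + dist z f₂ ≤ r} :=
  isClosed_le (by fun_prop) continuous_const

theorem convex_setOf_dist_add_dist_le {E : Type*} [SeminormedAddCommGroup E] [NormedSpace ℝ E]
    (f₁ f₂ : E) (r : ℝ) :
    Convex ℝ {z | dist z f₁ + dist z f₂ ≤ r} := by
  simpa using ((convexOn_univ_dist f₁).add (convexOn_univ_dist f₂)).convex_le r

theorem isEllipticalDisk_of_isGreatest {K : Set ℂ} (hK : IsClosed K) (hconv : Convex ℝ K)
    {f₁ f₂ : ℂ} {b : ℝ} (hb : 0 < b)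
    (h : ∀ u : ℂ, ‖u‖ = 1 → ∀ t, inner ℝ u f₁ < t → inner ℝ u f₂ < t →
      (t - inner ℝ u f₁) * (t - inner ℝ u f₂) = b →
        IsGreatest ((fun z => inner ℝ u z) '' K) t) :
    IsEllipticalDisk K f₁ f₂ := by
  choose t ht₁ ht₂ htb using fun u : ℂ => exists_lt_sub_mul_sub_eq (inner ℝ u f₁) (inner ℝ u f₂) hb
  set r := √(dist f₁ f₂ ^ 2 + 4 * b)
  have hr : r ^ 2 = dist f₁ f₂ ^ 2 + 4 * b := Real.sq_sqrt (by positivity)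
  have hgreatestK : ∀ u : ℂ, ‖u‖ = 1 → IsGreatest ((fun z => inner ℝ u z) '' K) (t u) :=
    fun u hu => h u hu (t u) (ht₁ u) (ht₂ u) (htb u)
  have hgreatestE : ∀ u : ℂ, ‖u‖ = 1 →
      IsGreatest ((fun z => inner ℝ u z) '' {z | dist z f₁ + dist z f₂ ≤ r}) (t u) :=
    fun u hu => isGreatest_inner_image_setOf_dist_add_dist_le hu (Real.sqrt_nonneg _)
      (ht₁ u) (ht₂ u) (by rw [htb, hr]; ring)
  refine ⟨r, Real.lt_sqrt_of_sq_lt (by linarith), ?_⟩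
  rw [eq_setOf_forall_unit_inner_le_of_isGreatest hK hconv
      (hgreatestK 1 norm_one).nonempty.of_image hgreatestK,
    ← eq_setOf_forall_unit_inner_le_of_isGreatest (isClosed_setOf_dist_add_dist_le f₁ f₂ r)
      (convex_setOf_dist_add_dist_le f₁ f₂ r) (hgreatestE 1 norm_one).nonempty.of_image hgreatestE]

theorem IsEllipticalDisk.exists_isGreatest {K : Set ℂ} {f₁ f₂ : ℂ}
    (hK : IsEllipticalDisk K f₁ f₂) :
    ∃ b : ℝ, 0 < b ∧ ∀ u : ℂ, ‖u‖ = 1 → ∀ t, inner ℝ u f₁ < t → inner ℝ u f₂ < t →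
      (t - inner ℝ u f₁) * (t - inner ℝ u f₂) = b →
        IsGreatest ((fun z => inner ℝ u z) '' K) t := by
  obtain ⟨r, hr, rfl⟩ := hK
  have hr0 : 0 ≤ r := dist_nonneg.trans hr.le
  refine ⟨(r ^ 2 - dist f₁ f₂ ^ 2) / 4, ?_, fun u hu t ht₁ ht₂ hprod => ?_⟩
  · linarith [(sq_lt_sq₀ dist_nonneg hr0).2 hr]
  · exact isGreatest_inner_image_setOf_dist_add_dist_le hu hr0 ht₁ ht₂ (by rw [hprod]; ring)

end EllipticalDisks

section ToeplitzHausdorff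

theorem exists_ne_zero_isotropic {E : Type*} [AddCommGroup E] [Module ℂ E]
    (Q : E →ₗ⋆[ℂ] E →ₗ[ℂ] ℂ) {x y : E} {a b : ℝ} (hx : Q x x = a) (hy : Q y y = b)
    (ha : a < 0) (hb : 0 < b) : ∃ z, z ≠ 0 ∧ Q z z = 0 := by
  obtain ⟨c, hc, hphase⟩ := Complex.exists_norm_eq_mul_self (Q y x - conj (Q x y))
  have hcc : conj c * c = 1 := by rw [Complex.conj_mul', hc]; norm_num
  -- The phase `c` makes the quadratic form real on the path `(1 - s) c x + s y`.
  obtain ⟨g, hg⟩ : ∃ g : ℝ, conj c * Q x y + c * Q y x = g := by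
    refine ⟨_, (Complex.conj_eq_iff_re.1 ?_).symm⟩
    have hreal : conj (c * (Q y x - conj (Q x y))) = c * (Q y x - conj (Q x y)) := by
      rw [← hphase, Complex.conj_ofReal]
    simp only [map_add, map_mul, map_sub, Complex.conj_conj] at hreal ⊢
    linear_combination hreal
  have hpath (s : ℝ) :
      Q (((1 - s : ℝ) * c) • x + (s : ℂ) • y) (((1 - s : ℝ) * c) • x + (s : ℂ) • y) =
        ((1 - s) ^ 2 * a + s ^ 2 * b + s * (1 - s) * g : ℝ) := by
    simp only [map_add, map_smul, map_smulₛₗ, LinearMap.add_apply, LinearMap.smul_apply,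
      smul_eq_mul, map_mul, Complex.conj_ofReal, hx, hy]
    push_cast
    linear_combination (1 - s : ℂ) ^ 2 * a * hcc + s * (1 - s : ℂ) * hg
  obtain ⟨s, hs, hzero⟩ : ∃ s ∈ Set.Icc (0 : ℝ) 1,
      (1 - s) ^ 2 * a + s ^ 2 * b + s * (1 - s) * g = 0 :=
    intermediate_value_Icc zero_le_one (by fun_prop) ⟨by simpa using ha.le, by simpa using hb.le⟩
  refine ⟨_, fun hdep => ?_, by rw [hpath s, hzero, Complex.ofReal_zero]⟩
  have hparallel : (s : ℂ) • y = -(((1 - s : ℝ) * c) • x) := (neg_eq_of_add_eq_zero_right hdep).symm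
  have hsigns : ((s ^ 2 * b : ℝ) : ℂ) = ((1 - s) ^ 2 * a : ℝ) := by
    have := congrArg (fun v => Q v v) hparallel
    simp only [map_neg, LinearMap.neg_apply, map_smul, map_smulₛₗ, LinearMap.smul_apply,
      smul_eq_mul, map_mul, Complex.conj_ofReal, hx, hy] at this
    push_cast at this ⊢
    linear_combination this + (1 - s : ℂ) ^ 2 * a * hcc
  rw [Complex.ofReal_inj] at hsigns
  have hsb : s ^ 2 * b = 0 := le_antisymm
    (hsigns.trans_le (mul_nonpos_of_nonneg_of_nonpos (sq_nonneg _) ha.le)) (by positivity)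
  obtain rfl : s = 0 := by simpa [hb.ne'] using hsb
  linarith

end ToeplitzHausdorff

section NumericalRange

open Matrix ComplexOrder

variable {n : ℕ} {A : Matrix (Fin n) (Fin n) ℂ} {u z : ℂ} {t : ℝ}

theorem mem_numericalRange_iff :
    z ∈ numericalRange A ↔ ∃ x : Fin n → ℂ, x ≠ 0 ∧ star x ⬝ᵥ (A *ᵥ x) = z * (star x ⬝ᵥ x) := by
  have hinner (x : EuclideanSpace ℂ (Fin n)) :
      inner ℂ x (toEuclideanLin A x) = star x.ofLp ⬝ᵥ (A *ᵥ x.ofLp) :=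
    dotProduct_comm _ _
  have hnorm (x : EuclideanSpace ℂ (Fin n)) : star x.ofLp ⬝ᵥ x.ofLp = (‖x‖ : ℂ) ^ 2 :=
    (dotProduct_comm _ _).trans (inner_self_eq_norm_sq_to_K (𝕜 := ℂ) x)
  constructor
  · rintro ⟨x, hx, rfl⟩
    refine ⟨x.ofLp, ?_, ?_⟩
    · rintro h0
      simp [(WithLp.ofLp_eq_zero 2).1 h0] at hx
    · rw [hinner, hnorm, hx]
      simp
  · rintro ⟨x, hx, hxz⟩
    have hx0 : WithLp.toLp 2 x ≠ 0 := by simpa using hx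
    have hx_norm : (‖WithLp.toLp 2 x‖ : ℂ) ≠ 0 := by simpa using hx
    refine ⟨(‖WithLp.toLp 2 x‖⁻¹ : ℂ) • WithLp.toLp 2 x, norm_smul_inv_norm hx0, ?_⟩
    rw [map_smul, inner_smul_left, inner_smul_right, hinner, hxz, hnorm, map_inv₀,
      Complex.conj_ofReal]
    field_simp

theorem isCompact_numericalRange (A : Matrix (Fin n) (Fin n) ℂ) :
    IsCompact (numericalRange A) := by
  have himage : numericalRange A = (fun x : EuclideanSpace ℂ (Fin n) =>
      inner ℂ x (toEuclideanLin A x)) '' Metric.sphere 0 1 := by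
    ext w
    simp [numericalRange, eq_comm]
  rw [himage]
  refine (isCompact_sphere _ _).image ?_
  have := (toEuclideanLin A).continuous_of_finiteDimensional
  fun_prop

theorem toLinearMapₛₗ₂'_conj_apply (M : Matrix (Fin n) (Fin n) ℂ) (x y : Fin n → ℂ) :
    toLinearMapₛₗ₂' ℂ (starRingEnd ℂ) (RingHom.id ℂ) M x y = star x ⬝ᵥ (M *ᵥ y) := by
  simp [toLinearMapₛₗ₂'_apply, dotProduct, mulVec, Finset.mul_sum, mul_comm]

theorem exists_pos_star_dotProduct_self_eq {x : Fin n → ℂ} (hx : x ≠ 0) :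
    ∃ N : ℝ, 0 < N ∧ star x ⬝ᵥ x = N := by
  obtain ⟨N, hN, hxN⟩ := RCLike.pos_iff_exists_ofReal.1 (dotProduct_star_self_pos_iff.2 hx)
  exact ⟨N, hN, hxN.symm⟩

theorem convex_numericalRange (A : Matrix (Fin n) (Fin n) ℂ) :
    Convex ℝ (numericalRange A) := by
  refine convex_iff_forall_pos.2 fun p hp q hq α β hα hβ hαβ => ?_
  rcases eq_or_ne p q with rfl | hpq
  · rwa [Convex.combo_self hαβ]
  have hqp : q - p ≠ 0 := sub_ne_zero.2 hpq.symm
  have hαβ' : (α + β : ℂ) = 1 := by exact_mod_cast hαβ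
  set w := α • p + β • q with hw
  rw [Complex.real_smul, Complex.real_smul] at hw
  set B := (q - p)⁻¹ • (A - w • 1) with hB
  have hform (x : Fin n → ℂ) :
      star x ⬝ᵥ (B *ᵥ x) = (q - p)⁻¹ * (star x ⬝ᵥ (A *ᵥ x) - w * (star x ⬝ᵥ x)) := by
    simp [hB, sub_mulVec, smul_mulVec]
  obtain ⟨x, hx, hxp⟩ := mem_numericalRange_iff.1 hp
  obtain ⟨y, hy, hyq⟩ := mem_numericalRange_iff.1 hq
  obtain ⟨Nx, hNx, hNx_eq⟩ := exists_pos_star_dotProduct_self_eq hx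
  obtain ⟨Ny, hNy, hNy_eq⟩ := exists_pos_star_dotProduct_self_eq hy
  have hBx : star x ⬝ᵥ (B *ᵥ x) = (-(β * Nx) : ℝ) := by
    rw [hform, hxp, hNx_eq, inv_mul_eq_iff_eq_mul₀ hqp]
    push_cast
    linear_combination -Nx * hw - p * Nx * hαβ'
  have hBy : star y ⬝ᵥ (B *ᵥ y) = (α * Ny : ℝ) := by
    rw [hform, hyq, hNy_eq, inv_mul_eq_iff_eq_mul₀ hqp]
    push_cast
    linear_combination -Ny * hw - q * Ny * hαβ'
  simp only [← toLinearMapₛₗ₂'_conj_apply] at hBx hBy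
  obtain ⟨v, hv, hBv⟩ := exists_ne_zero_isotropic _ hBx hBy (by nlinarith) (by positivity)
  rw [toLinearMapₛₗ₂'_conj_apply, hform, mul_eq_zero, sub_eq_zero] at hBv
  exact mem_numericalRange_iff.2 ⟨v, hv, hBv.resolve_left (inv_ne_zero hqp)⟩

end NumericalRange

section SupportPencil

open Matrix ComplexOrder

variable {n : ℕ} {A : Matrix (Fin n) (Fin n) ℂ} {u z : ℂ} {t : ℝ} {x : Fin n → ℂ}

/-- The Hermitian pencil `2t - (ū A + u Aᴴ)`. For a unit vector `u` it is positive semidefinite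
exactly when the half-plane `Re (ū z) ≤ t` contains the numerical range of `A`, and it is singular
when the line bounding that half-plane supports the range. -/
noncomputable def supportPencil (A : Matrix (Fin n) (Fin n) ℂ) (u : ℂ) (t : ℝ) :
    Matrix (Fin n) (Fin n) ℂ :=
  (2 * t : ℂ) • 1 - (conj u • A + u • Aᴴ)

theorem two_mul_ofReal_inner (u w : ℂ) :
    2 * ((inner ℝ u w : ℝ) : ℂ) = conj u * w + u * conj w := by
  apply Complex.ext <;> simp [Complex.inner] <;> ring

theorem isHermitian_supportPencil (A : Matrix (Fin n) (Fin n) ℂ) (u : ℂ) (t : ℝ) :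
    (supportPencil A u t).IsHermitian := by
  simp [supportPencil, IsHermitian, add_comm]

theorem supportPencil_neg_neg (A : Matrix (Fin n) (Fin n) ℂ) (u : ℂ) (t : ℝ) :
    supportPencil A (-u) (-t) = -supportPencil A u t := by
  simp only [supportPencil, map_neg, Complex.ofReal_neg, mul_neg, neg_smul]
  abel

theorem supportPencil_inner_mulVec (A : Matrix (Fin n) (Fin n) ℂ) (u z : ℂ) (x : Fin n → ℂ) :
    supportPencil A u (inner ℝ u z) *ᵥ x =
      -(conj u • (A *ᵥ x - z • x) + u • (Aᴴ *ᵥ x - conj z • x)) := by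
  rw [supportPencil, two_mul_ofReal_inner]
  simp only [sub_mulVec, add_mulVec, smul_mulVec, one_mulVec]
  module

theorem star_dotProduct_supportPencil_mulVec
    (hx : star x ⬝ᵥ (A *ᵥ x) = z * (star x ⬝ᵥ x)) (u : ℂ) (t : ℝ) :
    star x ⬝ᵥ (supportPencil A u t *ᵥ x) = (2 * (t - inner ℝ u z) : ℝ) * (star x ⬝ᵥ x) := by
  have hx_conj : star x ⬝ᵥ (Aᴴ *ᵥ x) = conj z * (star x ⬝ᵥ x) := by
    have := congrArg star hx
    rwa [star_mul', star_dotProduct, star_star, star_mulVec, ← dotProduct_mulVec,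
      ← star_dotProduct] at this
  simp only [supportPencil, sub_mulVec, add_mulVec, smul_mulVec, one_mulVec, dotProduct_sub,
    dotProduct_add, dotProduct_smul, smul_eq_mul, hx, hx_conj]
  push_cast
  linear_combination (star x ⬝ᵥ x) * two_mul_ofReal_inner u z

theorem exists_mem_numericalRange_of_ne_zero (A : Matrix (Fin n) (Fin n) ℂ) (hx : x ≠ 0) :
    ∃ z ∈ numericalRange A, star x ⬝ᵥ (A *ᵥ x) = z * (star x ⬝ᵥ x) := by
  have hxz : star x ⬝ᵥ (A *ᵥ x) = star x ⬝ᵥ (A *ᵥ x) / (star x ⬝ᵥ x) * (star x ⬝ᵥ x) :=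
    (div_mul_cancel₀ _ (dotProduct_star_self_eq_zero.not.2 hx)).symm
  exact ⟨_, mem_numericalRange_iff.2 ⟨x, hx, hxz⟩, hxz⟩

theorem posSemidef_supportPencil (h : ∀ z ∈ numericalRange A, inner ℝ u z ≤ t) :
    (supportPencil A u t).PosSemidef := by
  refine .of_dotProduct_mulVec_nonneg (isHermitian_supportPencil A u t) fun x => ?_
  rcases eq_or_ne x 0 with rfl | hx
  · simp
  obtain ⟨z, hz, hxz⟩ := exists_mem_numericalRange_of_ne_zero A hx
  rw [star_dotProduct_supportPencil_mulVec hxz]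
  exact mul_nonneg (Complex.zero_le_real.2 (by linarith [h z hz])) (dotProduct_star_self_nonneg x)

theorem supportPencil_mulVec_eq_zero (h : ∀ w ∈ numericalRange A, inner ℝ u w ≤ inner ℝ u z)
    (hx : star x ⬝ᵥ (A *ᵥ x) = z * (star x ⬝ᵥ x)) :
    supportPencil A u (inner ℝ u z) *ᵥ x = 0 := by
  rw [← (posSemidef_supportPencil h).dotProduct_mulVec_zero_iff,
    star_dotProduct_supportPencil_mulVec hx, sub_self, mul_zero, Complex.ofReal_zero, zero_mul]

theorem det_supportPencil_eq_zero_of_isGreatest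
    (h : IsGreatest ((fun z => inner ℝ u z) '' numericalRange A) t) :
    (supportPencil A u t).det = 0 := by
  obtain ⟨⟨z, hz, rfl⟩, hub⟩ := h
  obtain ⟨x, hx, hxz⟩ := mem_numericalRange_iff.1 hz
  exact exists_mulVec_eq_zero_iff.1
    ⟨x, hx, supportPencil_mulVec_eq_zero (fun w hw => hub ⟨w, hw, rfl⟩) hxz⟩

theorem exists_mem_numericalRange_inner_eq (h : (supportPencil A u t).det = 0) :
    ∃ z ∈ numericalRange A, inner ℝ u z = t := by
  obtain ⟨x, hx, hx_ker⟩ := exists_mulVec_eq_zero_iff.2 h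
  obtain ⟨z, hz, hxz⟩ := exists_mem_numericalRange_of_ne_zero A hx
  have hzero := star_dotProduct_supportPencil_mulVec hxz u t
  rw [hx_ker, dotProduct_zero, zero_eq_mul, dotProduct_star_self_eq_zero, or_iff_left hx,
    Complex.ofReal_eq_zero] at hzero
  exact ⟨z, hz, by linarith⟩

theorem isGreatest_inner_image_numericalRange
    (h : IsGreatest {s : ℝ | (supportPencil A u s).det = 0} t) :
    IsGreatest ((fun z => inner ℝ u z) '' numericalRange A) t := by
  obtain ⟨z, hz, hzt⟩ := exists_mem_numericalRange_inner_eq h.1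
  obtain ⟨s, hs⟩ := ((isCompact_numericalRange A).image
    (f := fun z => inner ℝ u z) (by fun_prop)).exists_isGreatest ⟨_, z, hz, rfl⟩
  have hts : t ≤ s := hs.2 ⟨z, hz, hzt⟩
  have hst : s ≤ t := h.2 (det_supportPencil_eq_zero_of_isGreatest hs)
  rwa [le_antisymm hts hst]

end SupportPencil

section BoundaryRegularity

open Matrix

variable {n : ℕ} {A : Matrix (Fin n) (Fin n) ℂ} {p u v : ℂ} {t : ℝ}

/-- A common eigenvector of `A` and `Aᴴ` with conjugate eigenvalues `p` and `conj p` spans a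
reducing subspace of `A`; by Donoghue's theorem this happens at every corner `p` of the numerical
range. -/
def HasReducingEigenvalue (A : Matrix (Fin n) (Fin n) ℂ) (p : ℂ) : Prop :=
  ∃ x : Fin n → ℂ, x ≠ 0 ∧ A *ᵥ x = p • x ∧ Aᴴ *ᵥ x = conj p • x

theorem conj_mul_self_of_norm_eq_one (hu : ‖u‖ = 1) : conj u * u = 1 := by
  rw [Complex.conj_mul', hu, Complex.ofReal_one, one_pow]

theorem conj_mul_ne_of_ne_of_ne_neg (hu : ‖u‖ = 1) (hv : ‖v‖ = 1) (huv : u ≠ v) (huv' : u ≠ -v) :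
    conj u * v ≠ conj v * u := by
  intro h
  have hsq : u ^ 2 = v ^ 2 := by
    linear_combination -u * v * h - u ^ 2 * conj_mul_self_of_norm_eq_one hv +
      v ^ 2 * conj_mul_self_of_norm_eq_one hu
  exact (sq_eq_sq_iff_eq_or_eq_neg.1 hsq).elim huv huv'

theorem hasReducingEigenvalue_of_supporting_lines (hp : p ∈ numericalRange A)
    (hu : ‖u‖ = 1) (hv : ‖v‖ = 1) (huv : u ≠ v) (huv' : u ≠ -v)
    (hup : ∀ z ∈ numericalRange A, inner ℝ u z ≤ inner ℝ u p)
    (hvp : ∀ z ∈ numericalRange A, inner ℝ v z ≤ inner ℝ v p) : HasReducingEigenvalue A p := by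
  obtain ⟨x, hx, hxp⟩ := mem_numericalRange_iff.1 hp
  have hu_ker := supportPencil_mulVec_eq_zero hup hxp
  have hv_ker := supportPencil_mulVec_eq_zero hvp hxp
  rw [supportPencil_inner_mulVec, neg_eq_zero] at hu_ker hv_ker
  have hdet : conj u * v - conj v * u ≠ 0 :=
    sub_ne_zero.2 (conj_mul_ne_of_ne_of_ne_neg hu hv huv huv')
  refine ⟨x, hx, sub_eq_zero.1 ((smul_eq_zero_iff_right hdet).1 ?_),
    sub_eq_zero.1 ((smul_eq_zero_iff_right hdet).1 ?_)⟩
  · linear_combination (norm := module) v • hu_ker - u • hv_ker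
  · linear_combination (norm := module) conj u • hv_ker - conj v • hu_ker

theorem exists_hasReducingEigenvalue_of_inner_eq [NeZero n] (hu : ‖u‖ = 1)
    (h : ∀ z ∈ numericalRange A, inner ℝ u z = t) : ∃ p, HasReducingEigenvalue A p := by
  obtain ⟨p, hp⟩ := Module.End.exists_eigenvalue A.mulVecLin
  obtain ⟨x, hx⟩ := hp.exists_hasEigenvector
  have hxp : A *ᵥ x = p • x := hx.apply_eq_smul
  have hray : star x ⬝ᵥ (A *ᵥ x) = p * (star x ⬝ᵥ x) := by
    rw [hxp, dotProduct_smul, smul_eq_mul]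
  have hp_mem : p ∈ numericalRange A := mem_numericalRange_iff.2 ⟨x, hx.2, hray⟩
  have hker := supportPencil_mulVec_eq_zero (u := u)
    (fun z hz => ((h z hz).trans (h p hp_mem).symm).le) hray
  rw [supportPencil_inner_mulVec, hxp, sub_self, smul_zero, zero_add, neg_eq_zero,
    smul_eq_zero_iff_right (norm_ne_zero_iff.1 (hu ▸ one_ne_zero))] at hker
  exact ⟨p, x, hx.2, hxp, sub_eq_zero.1 hker⟩

theorem nonempty_numericalRange [NeZero n] (A : Matrix (Fin n) (Fin n) ℂ) :
    (numericalRange A).Nonempty :=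
  ⟨_, EuclideanSpace.single 0 1, by simp, rfl⟩

theorem nonempty_interior_numericalRange [NeZero n] (hA : ∀ p, ¬ HasReducingEigenvalue A p) :
    (interior (numericalRange A)).Nonempty := by
  by_contra! hint
  obtain ⟨u, hu, t, ht⟩ := exists_unit_inner_eq_of_interior_eq_empty (convex_numericalRange A)
    (nonempty_numericalRange A) hint
  obtain ⟨p, hp⟩ := exists_hasReducingEigenvalue_of_inner_eq hu ht
  exact hA p hp

theorem hasSmoothBoundary_numericalRange [NeZero n] (hA : ∀ p, ¬ HasReducingEigenvalue A p) :
    HasSmoothBoundary (numericalRange A) := by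
  intro p hp
  have hp_mem : p ∈ numericalRange A := (isCompact_numericalRange A).isClosed.frontier_subset hp
  obtain ⟨u, hu, hup⟩ := exists_unit_supporting_normal (convex_numericalRange A) hp_mem hp.2
  refine ⟨u, ⟨hu, hup⟩, fun v ⟨hv, hvp⟩ => ?_⟩
  by_contra hvu
  rcases eq_or_ne v (-u) with rfl | hvu'
  · have hline : ∀ z ∈ numericalRange A, inner ℝ u z = inner ℝ u p := fun z hz =>
      (hup z hz).antisymm (by simpa only [inner_neg_left, neg_le_neg_iff] using hvp z hz)
    obtain ⟨q, hq⟩ := exists_hasReducingEigenvalue_of_inner_eq hu hline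
    exact hA q hq
  · exact hA p (hasReducingEigenvalue_of_supporting_lines hp_mem hv hu hvu hvu' hvp hup)

theorem inner_left_eq_inner_midpoint {V : Type*} [NormedAddCommGroup V] [InnerProductSpace ℝ V]
    {u p q : V} (hp : inner ℝ u p ≤ inner ℝ u (midpoint ℝ p q))
    (hq : inner ℝ u q ≤ inner ℝ u (midpoint ℝ p q)) :
    inner ℝ u p = inner ℝ u (midpoint ℝ p q) := by
  rw [midpoint_eq_smul_add, real_inner_smul_right, inner_add_right, invOf_eq_inv] at hp hq ⊢
  linarith

theorem star_smul_dotProduct_mulVec_smul_eq_iff {c : ℂ} (hc : c ≠ 0) (x : Fin n → ℂ) :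
    star (c • x) ⬝ᵥ (A *ᵥ (c • x)) = p * (star (c • x) ⬝ᵥ (c • x)) ↔
      star x ⬝ᵥ (A *ᵥ x) = p * (star x ⬝ᵥ x) := by
  rw [star_smul, mulVec_smul, smul_dotProduct, dotProduct_smul, smul_dotProduct, dotProduct_smul,
    mul_smul_comm, mul_smul_comm, smul_right_inj (star_ne_zero.2 hc), smul_right_inj hc]

theorem not_hasFlatPortion_numericalRange
    (hker : ∀ u : ℂ, ‖u‖ = 1 → ∀ t : ℝ,
      Module.finrank ℂ (supportPencil A u t).mulVecLin.ker ≤ 1) :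
    ¬ HasFlatPortion (numericalRange A) := by
  rintro ⟨p, q, hpq, hseg⟩
  have hsubset := (isCompact_numericalRange A).isClosed.frontier_subset
  have hm : midpoint ℝ p q ∈ frontier (numericalRange A) := hseg (midpoint_mem_segment p q)
  obtain ⟨u, hu, hum⟩ := exists_unit_supporting_normal (convex_numericalRange A) (hsubset hm) hm.2
  have hp := hsubset (hseg (left_mem_segment ℝ p q))
  have hq := hsubset (hseg (right_mem_segment ℝ p q))
  have hup : inner ℝ u p = inner ℝ u (midpoint ℝ p q) :=
    inner_left_eq_inner_midpoint (hum p hp) (hum q hq)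
  have huq : inner ℝ u q = inner ℝ u (midpoint ℝ p q) := by
    rw [midpoint_comm] at hum ⊢
    exact inner_left_eq_inner_midpoint (hum q hq) (hum p hp)
  obtain ⟨x, hx, hxp⟩ := mem_numericalRange_iff.1 hp
  obtain ⟨y, hy, hyq⟩ := mem_numericalRange_iff.1 hq
  have hx_ker := hup ▸ supportPencil_mulVec_eq_zero (hup ▸ hum) hxp
  have hy_ker := huq ▸ supportPencil_mulVec_eq_zero (huq ▸ hum) hyq
  obtain ⟨v, hv⟩ := finrank_le_one_iff.1 (hker u hu (inner ℝ u (midpoint ℝ p q)))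
  obtain ⟨c, hc⟩ := hv ⟨x, hx_ker⟩
  obtain ⟨d, hd⟩ := hv ⟨y, hy_ker⟩
  obtain rfl : c • (v : Fin n → ℂ) = x := congrArg Subtype.val hc
  obtain rfl : d • (v : Fin n → ℂ) = y := congrArg Subtype.val hd
  rw [smul_ne_zero_iff] at hx hy
  rw [star_smul_dotProduct_mulVec_smul_eq_iff hx.1] at hxp
  rw [star_smul_dotProduct_mulVec_smul_eq_iff hy.1, hxp] at hyq
  obtain ⟨N, hN, hv_norm⟩ := exists_pos_star_dotProduct_self_eq hx.2
  rw [hv_norm] at hyq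
  exact hpq (mul_right_cancel₀ (Complex.ofReal_ne_zero.2 hN.ne') hyq)

end BoundaryRegularity

section EllipticalNumericalRange

open Matrix

variable {n : ℕ} {A : Matrix (Fin n) (Fin n) ℂ} {f₁ f₂ : ℂ}

theorem isEllipticalDisk_numericalRange {g : ℂ} {b : ℝ} (hb : 0 < b) (hg : g ∈ segment ℝ f₁ f₂)
    (hdet : ∀ u : ℂ, ‖u‖ = 1 → ∀ t : ℝ, (supportPencil A u t).det = 0 ↔
      t = inner ℝ u g ∨ (t - inner ℝ u f₁) * (t - inner ℝ u f₂) = b) :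
    IsEllipticalDisk (numericalRange A) f₁ f₂ := by
  refine isEllipticalDisk_of_isGreatest (isCompact_numericalRange A).isClosed
    (convex_numericalRange A) hb fun u hu t ht₁ ht₂ htb =>
      isGreatest_inner_image_numericalRange ⟨(hdet u hu t).2 (.inr htb), fun s hs => ?_⟩
  rcases (hdet u hu s).1 hs with rfl | hsb
  · exact ((convex_halfSpace_lt (innerₗ ℂ u).isLinear t).segment_subset ht₁ ht₂ hg).le
  · by_contra! hts
    have := mul_lt_mul'' (sub_lt_sub_right hts (inner ℝ u f₁)) (sub_lt_sub_right hts (inner ℝ u f₂))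
      (sub_nonneg.2 ht₁.le) (sub_nonneg.2 ht₂.le)
    linarith

theorem IsEllipticalDisk.exists_det_supportPencil_eq_zero
    (h : IsEllipticalDisk (numericalRange A) f₁ f₂) :
    ∃ b : ℝ, 0 < b ∧ ∀ u : ℂ, ‖u‖ = 1 → ∀ t : ℝ,
      (t - inner ℝ u f₁) * (t - inner ℝ u f₂) = b → (supportPencil A u t).det = 0 := by
  obtain ⟨b, hb, hgreatest⟩ := h.exists_isGreatest
  refine ⟨b, hb, fun u hu t ht => ?_⟩
  rcases mul_pos_iff.1 (ht ▸ hb) with ⟨ht₁, ht₂⟩ | ⟨ht₁, ht₂⟩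
  · exact det_supportPencil_eq_zero_of_isGreatest
      (hgreatest u hu t (sub_pos.1 ht₁) (sub_pos.1 ht₂) ht)
  · have hdet := det_supportPencil_eq_zero_of_isGreatest
      (hgreatest (-u) (by rwa [norm_neg]) (-t) (by rw [inner_neg_left]; linarith)
        (by rw [inner_neg_left]; linarith) (by rw [inner_neg_left, inner_neg_left, ← ht]; ring))
    rwa [supportPencil_neg_neg, det_neg, mul_eq_zero_iff_left (by simp)] at hdet

end EllipticalNumericalRange

section RankTwoPartialIsometry

open Matrix

variable {μ₁ μ₂ u : ℂ} {t : ℝ}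

theorem one_sub_norm_sq_pos {E : Type*} [SeminormedAddGroup E] {x : E} (h : ‖x‖ < 1) :
    0 < 1 - ‖x‖ ^ 2 :=
  sub_pos.2 (pow_lt_one₀ (norm_nonneg x) h two_ne_zero)

theorem ofReal_sqrt_one_sub_norm_sq_sq {μ : ℂ} (h : ‖μ‖ ≤ 1) :
    (√(1 - ‖μ‖ ^ 2) : ℂ) ^ 2 = 1 - (‖μ‖ : ℂ) ^ 2 := by
  exact_mod_cast Real.sq_sqrt (sub_nonneg.2 (pow_le_one₀ (norm_nonneg μ) h))

theorem ofReal_sqrt_one_sub_norm_sq_ne_zero {μ : ℂ} (h : ‖μ‖ < 1) :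
    (√(1 - ‖μ‖ ^ 2) : ℂ) ≠ 0 :=
  Complex.ofReal_ne_zero.2 (Real.sqrt_pos.2 (one_sub_norm_sq_pos h)).ne'

theorem supportPencil_rankTwoPartialIsometry (μ₁ μ₂ u : ℂ) (t : ℝ) :
    supportPencil (rankTwoPartialIsometry μ₁ μ₂) u t =
      !![2 * (t : ℂ), -(conj u * √(1 - ‖μ₁‖ ^ 2)), conj u * conj μ₁ * √(1 - ‖μ₂‖ ^ 2);
        -(u * √(1 - ‖μ₁‖ ^ 2)), 2 * (t - (inner ℝ u μ₁ : ℝ)),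
          -(conj u * √(1 - ‖μ₁‖ ^ 2) * √(1 - ‖μ₂‖ ^ 2));
        u * μ₁ * √(1 - ‖μ₂‖ ^ 2), -(u * √(1 - ‖μ₁‖ ^ 2) * √(1 - ‖μ₂‖ ^ 2)),
          2 * (t - (inner ℝ u μ₂ : ℝ))] := by
  simp only [mul_sub, two_mul_ofReal_inner]
  ext i j
  fin_cases i <;> fin_cases j <;> simp [supportPencil, rankTwoPartialIsometry, mul_assoc]

theorem det_supportPencil_rankTwoPartialIsometry (h₁ : ‖μ₁‖ ≤ 1) (h₂ : ‖μ₂‖ ≤ 1) (hu : ‖u‖ = 1)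
    (t : ℝ) :
    (supportPencil (rankTwoPartialIsometry μ₁ μ₂) u t).det =
      ((8 * (t * (t - inner ℝ u μ₁) * (t - inner ℝ u μ₂) -
        ((1 - ‖μ₂‖ ^ 2) * (t - inner ℝ u μ₁) + (1 - ‖μ₁‖ ^ 2) * (t - inner ℝ u μ₂)) / 4) : ℝ) :
          ℂ) := by
  have hs₁ := ofReal_sqrt_one_sub_norm_sq_sq h₁
  have hs₂ := ofReal_sqrt_one_sub_norm_sq_sq h₂
  have huu := conj_mul_self_of_norm_eq_one hu
  have hμ₁ := Complex.conj_mul' μ₁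
  have hα := two_mul_ofReal_inner u μ₁
  rw [supportPencil_rankTwoPartialIsometry, det_fin_three]
  simp only [of_apply, cons_val', cons_val_zero, cons_val_one, cons_val]
  push_cast
  set s₁ := (√(1 - ‖μ₁‖ ^ 2) : ℂ)
  set s₂ := (√(1 - ‖μ₂‖ ^ 2) : ℂ)
  set α := ((inner ℝ u μ₁ : ℝ) : ℂ)
  set β := ((inner ℝ u μ₂ : ℝ) : ℂ)
  linear_combination
    (-2 * s₁ ^ 2 * (t - β) - 2 * t * s₁ ^ 2 * s₂ ^ 2 - 2 * conj μ₁ * μ₁ * s₂ ^ 2 * (t - α) +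
      s₁ ^ 2 * s₂ ^ 2 * (conj u * μ₁ + u * conj μ₁)) * huu - s₁ ^ 2 * s₂ ^ 2 * hα -
    2 * s₂ ^ 2 * (t - α) * hμ₁ - (2 * (t - β) + 2 * s₂ ^ 2 * (t - α)) * hs₁ - 2 * (t - α) * hs₂

theorem det_supportPencil_rankTwoPartialIsometry_eq_zero_iff (h₁ : ‖μ₁‖ ≤ 1) (h₂ : ‖μ₂‖ ≤ 1)
    (hu : ‖u‖ = 1) :
    (supportPencil (rankTwoPartialIsometry μ₁ μ₂) u t).det = 0 ↔
      t * (t - inner ℝ u μ₁) * (t - inner ℝ u μ₂) =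
        ((1 - ‖μ₂‖ ^ 2) * (t - inner ℝ u μ₁) + (1 - ‖μ₁‖ ^ 2) * (t - inner ℝ u μ₂)) / 4 := by
  rw [det_supportPencil_rankTwoPartialIsometry h₁ h₂ hu, Complex.ofReal_eq_zero,
    mul_eq_zero_iff_left (by norm_num), sub_eq_zero]

theorem isEllipticalDisk_numericalRange_rankTwoPartialIsometry_neg {μ : ℂ} (h : ‖μ‖ < 1) :
    IsEllipticalDisk (numericalRange (rankTwoPartialIsometry (-μ) μ)) (-μ) μ := by
  have hpos := one_sub_norm_sq_pos h
  refine isEllipticalDisk_numericalRange (g := 0) (b := (1 - ‖μ‖ ^ 2) / 2) (by positivity) ?_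
    fun u hu t => ?_
  · simpa [midpoint_eq_smul_add] using midpoint_mem_segment (𝕜 := ℝ) (-μ) μ
  · rw [det_supportPencil_rankTwoPartialIsometry_eq_zero_iff (by rw [norm_neg]; exact h.le) h.le hu,
      norm_neg, inner_neg_right, inner_zero_right, ← sub_eq_zero (b := (1 - ‖μ‖ ^ 2) / 2),
      ← mul_eq_zero, ← sub_eq_zero]
    ring_nf

theorem isEllipticalDisk_numericalRange_rankTwoPartialIsometry_self {μ : ℂ} (h : ‖μ‖ < 1) :
    IsEllipticalDisk (numericalRange (rankTwoPartialIsometry μ μ)) 0 μ := by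
  have hpos := one_sub_norm_sq_pos h
  refine isEllipticalDisk_numericalRange (g := μ) (b := (1 - ‖μ‖ ^ 2) / 2) (by positivity)
    (right_mem_segment ℝ 0 μ) fun u hu t => ?_
  rw [det_supportPencil_rankTwoPartialIsometry_eq_zero_iff h.le h.le hu, inner_zero_right,
    ← sub_eq_zero (a := t) (b := inner ℝ u μ), ← sub_eq_zero (b := (1 - ‖μ‖ ^ 2) / 2),
    ← mul_eq_zero, ← sub_eq_zero]
  ring_nf

theorem two_mul_mul_ne_one_add_sq {α β k t : ℝ} (hα : |α| ≤ 1) (hβ : |β| ≤ k) (hk : k < 1)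
    (ht : 2 * t = 2 * β + α * (1 - k ^ 2)) : 2 * t * α ≠ 1 + α ^ 2 := by
  have hα_bounds := abs_le.1 hα
  have hβ_bounds := abs_le.1 hβ
  have hk_pos : 0 < 1 - k ^ 2 := by nlinarith [abs_nonneg β]
  have ht_abs : |t| < 1 := abs_lt.2 ⟨by nlinarith, by nlinarith⟩
  nlinarith [(sq_lt_one_iff_abs_lt_one t).2 ht_abs, sq_nonneg (t - α)]

theorem mul_conj_eq_of_supportPencil_rankTwoPartialIsometry_mulVec_eq_zero (h₁ : ‖μ₁‖ ≤ 1)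
    (h₂ : ‖μ₂‖ < 1) (hu : ‖u‖ = 1) {x : Fin 3 → ℂ}
    (h : supportPencil (rankTwoPartialIsometry μ₁ μ₂) u t *ᵥ x = 0) (hx₀ : x 0 = 0)
    (hx₂ : x 2 ≠ 0) :
    (u * conj μ₁) * (1 - ‖μ₂‖ ^ 2 : ℝ) = (2 * (t - inner ℝ u μ₂) : ℝ) ∧
      2 * (t - (inner ℝ u μ₁ : ℝ)) * (u * conj μ₁) = (1 - ‖μ₁‖ ^ 2 : ℝ) := by
  have hs₁ := ofReal_sqrt_one_sub_norm_sq_sq h₁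
  have hs₂ := ofReal_sqrt_one_sub_norm_sq_sq h₂.le
  have hs₂_ne := ofReal_sqrt_one_sub_norm_sq_ne_zero h₂
  have huu := conj_mul_self_of_norm_eq_one hu
  rw [supportPencil_rankTwoPartialIsometry] at h
  have hrow₀ := congrFun h 0
  have hrow₁ := congrFun h 1
  have hrow₂ := congrFun h 2
  simp only [mulVec, dotProduct, Fin.sum_univ_three, of_apply, cons_val', cons_val_zero,
    cons_val_one, cons_val, Pi.zero_apply, hx₀, mul_zero, zero_add] at hrow₀ hrow₁ hrow₂
  push_cast
  set s₁ := (√(1 - ‖μ₁‖ ^ 2) : ℂ)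
  set s₂ := (√(1 - ‖μ₂‖ ^ 2) : ℂ)
  have hx₁ : s₁ * x 1 = conj μ₁ * s₂ * x 2 := by
    linear_combination (-u) * hrow₀ - (s₁ * x 1 - conj μ₁ * s₂ * x 2) * huu
  constructor
  · refine mul_right_cancel₀ hx₂ ?_
    linear_combination -hrow₂ - u * s₂ * hx₁ - u * conj μ₁ * x 2 * hs₂
  · refine mul_right_cancel₀ (mul_ne_zero hs₂_ne hx₂) ?_
    linear_combination u * s₁ * hrow₁ - 2 * (t - (inner ℝ u μ₁ : ℝ)) * u * hx₁ +
      s₁ ^ 2 * s₂ * x 2 * huu + s₂ * x 2 * hs₁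

theorem eq_zero_of_supportPencil_rankTwoPartialIsometry_mulVec_eq_zero (h₁ : ‖μ₁‖ < 1)
    (h₂ : ‖μ₂‖ < 1) (hu : ‖u‖ = 1) {x : Fin 3 → ℂ}
    (h : supportPencil (rankTwoPartialIsometry μ₁ μ₂) u t *ᵥ x = 0) (hx₀ : x 0 = 0) : x = 0 := by
  have hx₂ : x 2 = 0 := by
    by_contra hx₂
    obtain ⟨hreal, hprod⟩ := mul_conj_eq_of_supportPencil_rankTwoPartialIsometry_mulVec_eq_zero
      h₁.le h₂ hu h hx₀ hx₂
    obtain ⟨r, hr⟩ : ∃ r : ℝ, u * conj μ₁ = r := by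
      have hk : ((1 - ‖μ₂‖ ^ 2 : ℝ) : ℂ) ≠ 0 :=
        Complex.ofReal_ne_zero.2 (one_sub_norm_sq_pos h₂).ne'
      exact ⟨_, by rw [eq_div_of_mul_eq hk hreal, ← Complex.ofReal_div]⟩
    have hα : inner ℝ u μ₁ = r := by
      rw [← Complex.ofReal_re r, ← hr, Complex.inner, ← Complex.conj_re, map_mul, Complex.conj_conj,
        mul_comm]
    have hnorm : ‖μ₁‖ = |r| := by
      simpa [hu] using congrArg norm hr
    have hβ : |inner ℝ u μ₂| ≤ ‖μ₂‖ := by simpa [hu] using abs_real_inner_le_norm u μ₂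
    rw [hr] at hreal hprod
    rw [hα, hnorm, sq_abs] at hprod
    norm_cast at hreal hprod
    exact two_mul_mul_ne_one_add_sq (t := t) (hnorm ▸ h₁.le) hβ h₂ (by linarith) (by linarith)
  have hs₁ := ofReal_sqrt_one_sub_norm_sq_ne_zero h₁
  have hu₀ : u ≠ 0 := norm_ne_zero_iff.1 (hu ▸ one_ne_zero)
  have hx₁ : x 1 = 0 := by
    have hrow₀ := congrFun h 0
    simpa [supportPencil_rankTwoPartialIsometry, mulVec, dotProduct, Fin.sum_univ_three, hx₀, hx₂,
      hs₁, hu₀] using hrow₀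
  ext i
  fin_cases i <;> assumption

theorem finrank_ker_supportPencil_rankTwoPartialIsometry_le_one (h₁ : ‖μ₁‖ < 1) (h₂ : ‖μ₂‖ < 1)
    (hu : ‖u‖ = 1) (t : ℝ) :
    Module.finrank ℂ (supportPencil (rankTwoPartialIsometry μ₁ μ₂) u t).mulVecLin.ker ≤ 1 := by
  set P := supportPencil (rankTwoPartialIsometry μ₁ μ₂) u t
  rw [← Module.finrank_self ℂ]
  refine LinearMap.finrank_le_finrank_of_injective
    (f := LinearMap.proj (φ := fun _ : Fin 3 => ℂ) 0 ∘ₗ P.mulVecLin.ker.subtype) ?_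
  refine (injective_iff_map_eq_zero _).2 fun ⟨x, hx⟩ hx₀ => Subtype.ext ?_
  exact eq_zero_of_supportPencil_rankTwoPartialIsometry_mulVec_eq_zero h₁ h₂ hu hx hx₀

theorem not_hasReducingEigenvalue_rankTwoPartialIsometry (h₁ : ‖μ₁‖ < 1) (h₂ : ‖μ₂‖ < 1) (p : ℂ) :
    ¬ HasReducingEigenvalue (rankTwoPartialIsometry μ₁ μ₂) p := by
  rintro ⟨x, hx, hAx, hAx'⟩
  have hs₁_sq := ofReal_sqrt_one_sub_norm_sq_sq h₁.le
  have hs₁_ne := ofReal_sqrt_one_sub_norm_sq_ne_zero h₁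
  have hs₂_ne := ofReal_sqrt_one_sub_norm_sq_ne_zero h₂
  have hμ₁ := Complex.conj_mul' μ₁
  have hrow (i : Fin 3) := congrFun hAx i
  have hrow' (i : Fin 3) := congrFun hAx' i
  simp only [rankTwoPartialIsometry, mulVec, dotProduct, Fin.sum_univ_three, conjTranspose_apply,
    Pi.smul_apply, smul_eq_mul] at hrow hrow'
  set s₁ := (√(1 - ‖μ₁‖ ^ 2) : ℂ)
  set s₂ := (√(1 - ‖μ₂‖ ^ 2) : ℂ)
  have hrow₁ : μ₁ * x 1 + s₁ * s₂ * x 2 = p * x 1 := by simpa using hrow 1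
  have hrow₂ : μ₂ * x 2 = p * x 2 := by simpa using hrow 2
  have hpx₀ : p * x 0 = 0 := by simpa using hrow' 0
  have hx₁ : s₁ * x 1 = conj μ₁ * s₂ * x 2 := by
    simpa [hpx₀, add_neg_eq_zero] using hrow 0
  have hx₂ : x 2 = 0 := by
    have hne : 1 - μ₂ * conj μ₁ ≠ 0 := by
      refine sub_ne_zero.2 fun h => ?_
      have hlt := mul_lt_one_of_nonneg_of_lt_one_left (norm_nonneg μ₂) h₂ h₁.le
      rw [← Complex.norm_conj μ₁, ← norm_mul, ← h, norm_one] at hlt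
      exact lt_irrefl 1 hlt
    refine (mul_eq_zero.1 ?_).resolve_left (mul_ne_zero hs₂_ne hne)
    linear_combination s₁ * hrow₁ - conj μ₁ * s₂ * hrow₂ + (p - μ₁) * hx₁ -
      s₂ * x 2 * (hs₁_sq + hμ₁)
  have hx₁ : x 1 = 0 := by simpa [hx₂, hs₁_ne] using hx₁
  have hx₀ : x 0 = 0 := by simpa [hx₁, hx₂, hs₁_ne, s₁] using hrow' 1
  refine hx ?_
  ext i
  fin_cases i <;> assumption

theorem cubic_eq_zero_of_eq_zero_of_eq_zero {R : Type*} [CommRing R] [NoZeroDivisors R]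
    {e p q x y : R} (hxy : x ≠ y) (hx : x ^ 3 - e * x ^ 2 + p * x + q = 0)
    (hy : y ^ 3 - e * y ^ 2 + p * y + q = 0) :
    (e - x - y) ^ 3 - e * (e - x - y) ^ 2 + p * (e - x - y) + q = 0 := by
  have hquot : x ^ 2 + x * y + y ^ 2 - e * (x + y) + p = 0 :=
    (mul_eq_zero.1 (by linear_combination hx - hy)).resolve_left (sub_ne_zero.2 hxy)
  linear_combination hx + (e - 2 * x - y) * hquot

theorem mul_mul_eq_zero_of_inner_mul_inner_mul_inner_eq {a b c v : ℂ}
    (h : ∀ u : ℂ, ‖u‖ = 1 → inner ℝ u a * inner ℝ u b * inner ℝ u c = inner ℝ u v) :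
    a * b * c = 0 := by
  -- The cubic form `⟪u, a⟫⟪u, b⟫⟪u, c⟫ - |u|² ⟪u, v⟫` in `u = (x, y)` vanishes identically, and its
  -- value at the isotropic vector `(1, i)` is `a * b * c`; four directions determine that value.
  have hnorm (x y : ℝ) (hxy : x ^ 2 + y ^ 2 = 1) : ‖(⟨x, y⟩ : ℂ)‖ = 1 := by
    rw [← sq_eq_sq₀ (norm_nonneg _) zero_le_one, Complex.sq_norm, Complex.normSq_mk, ← sq, ← sq,
      hxy, one_pow]
  have h_one := h ⟨1, 0⟩ (hnorm _ _ (by norm_num))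
  have h_I := h ⟨0, 1⟩ (hnorm _ _ (by norm_num))
  have h_upper := h ⟨3 / 5, 4 / 5⟩ (hnorm _ _ (by norm_num))
  have h_lower := h ⟨3 / 5, -(4 / 5)⟩ (hnorm _ _ (by norm_num))
  simp only [Complex.inner, Complex.mul_re, Complex.conj_re, Complex.conj_im]
    at h_one h_I h_upper h_lower
  apply Complex.ext <;> simp only [Complex.mul_re, Complex.mul_im, Complex.zero_re, Complex.zero_im]
  · linear_combination (25 / 16) * h_one - (125 / 96) * (h_upper + h_lower)
  · linear_combination (125 / 72) * (h_upper - h_lower) - (25 / 9) * h_I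

theorem exists_inner_mul_inner_sub_mul_inner_sub_eq_of_isEllipticalDisk (h₁ : ‖μ₁‖ ≤ 1)
    (h₂ : ‖μ₂‖ ≤ 1) {f₁ f₂ : ℂ}
    (h : IsEllipticalDisk (numericalRange (rankTwoPartialIsometry μ₁ μ₂)) f₁ f₂) :
    ∃ w : ℂ, ∀ u : ℂ, ‖u‖ = 1 →
      inner ℝ u w * inner ℝ u (w - μ₁) * inner ℝ u (w - μ₂) =
        inner ℝ u ((4⁻¹ : ℝ) • ((1 - ‖μ₂‖ ^ 2) • (w - μ₁) + (1 - ‖μ₁‖ ^ 2) • (w - μ₂))) := by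
  obtain ⟨b, hb, hroot⟩ := h.exists_det_supportPencil_eq_zero
  refine ⟨μ₁ + μ₂ - f₁ - f₂, fun u hu => ?_⟩
  obtain ⟨t, ht₁, ht₂, ht⟩ := exists_lt_sub_mul_sub_eq (inner ℝ u f₁) (inner ℝ u f₂) hb
  have hcubic (s : ℝ) (hs : (s - inner ℝ u f₁) * (s - inner ℝ u f₂) = b) :
      s ^ 3 - (inner ℝ u μ₁ + inner ℝ u μ₂) * s ^ 2 +
        (inner ℝ u μ₁ * inner ℝ u μ₂ - (2 - ‖μ₂‖ ^ 2 - ‖μ₁‖ ^ 2) / 4) * s +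
          ((1 - ‖μ₂‖ ^ 2) * inner ℝ u μ₁ + (1 - ‖μ₁‖ ^ 2) * inner ℝ u μ₂) / 4 = 0 := by
    linear_combination
      (det_supportPencil_rankTwoPartialIsometry_eq_zero_iff h₁ h₂ hu).1 (hroot u hu s hs)
  have hthird := cubic_eq_zero_of_eq_zero_of_eq_zero
    (show t ≠ inner ℝ u f₁ + inner ℝ u f₂ - t from fun heq => by linarith) (hcubic t ht)
    (hcubic (inner ℝ u f₁ + inner ℝ u f₂ - t) (by linear_combination ht))
  simp only [real_inner_smul_right, inner_add_right, inner_sub_right]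
  linear_combination hthird

theorem eq_neg_of_smul_add_smul_eq_zero {V : Type*} [NormedAddCommGroup V] [NormedSpace ℝ V]
    {x y : V} (hx : ‖x‖ < 1) (hy : ‖y‖ < 1)
    (h : (1 - ‖y‖ ^ 2) • x + (1 - ‖x‖ ^ 2) • y = 0) : x = -y := by
  have hx_pos : 0 < 1 - ‖x‖ ^ 2 := one_sub_norm_sq_pos hx
  have hy_pos : 0 < 1 - ‖y‖ ^ 2 := one_sub_norm_sq_pos hy
  have hnorm : ‖x‖ = ‖y‖ := by
    have heq := congrArg norm (eq_neg_of_add_eq_zero_left h)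
    rw [norm_neg, norm_smul, norm_smul, Real.norm_of_nonneg hx_pos.le,
      Real.norm_of_nonneg hy_pos.le] at heq
    have hfactor : (‖x‖ - ‖y‖) * (1 + ‖x‖ * ‖y‖) = 0 := by linear_combination heq
    exact sub_eq_zero.1 ((mul_eq_zero.1 hfactor).resolve_right (by positivity))
  rw [hnorm, ← smul_add] at h
  exact eq_neg_of_add_eq_zero_left ((smul_eq_zero.1 h).resolve_left hy_pos.ne')

theorem not_isEllipticalDisk_numericalRange_rankTwoPartialIsometry (h₁ : ‖μ₁‖ < 1)
    (h₂ : ‖μ₂‖ < 1) (hneg : μ₁ ≠ -μ₂) (hne : μ₁ ≠ μ₂) (f₁ f₂ : ℂ) :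
    ¬ IsEllipticalDisk (numericalRange (rankTwoPartialIsometry μ₁ μ₂)) f₁ f₂ := by
  intro h
  obtain ⟨w, hw⟩ :=
    exists_inner_mul_inner_sub_mul_inner_sub_eq_of_isEllipticalDisk h₁.le h₂.le h
  have hcases : w = 0 ∨ w = μ₁ ∨ w = μ₂ := by
    simpa only [mul_eq_zero, sub_eq_zero, or_assoc] using
      mul_mul_eq_zero_of_inner_mul_inner_mul_inner_eq hw
  have hsum : (1 - ‖μ₂‖ ^ 2) • (w - μ₁) + (1 - ‖μ₁‖ ^ 2) • (w - μ₂) = 0 := by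
    refine (smul_eq_zero.1 (eq_zero_of_forall_unit_inner_eq_zero fun u hu => ?_)).resolve_left
      (inv_ne_zero (four_ne_zero (α := ℝ)))
    rw [← hw u hu]
    rcases hcases with rfl | rfl | rfl <;> simp
  rcases hcases with rfl | rfl | rfl
  · refine hneg (eq_neg_of_smul_add_smul_eq_zero h₁ h₂ ?_)
    simpa only [zero_sub, smul_neg, ← neg_add, neg_eq_zero] using hsum
  · rw [sub_self, smul_zero, zero_add] at hsum
    exact hne (sub_eq_zero.1 ((smul_eq_zero.1 hsum).resolve_left (one_sub_norm_sq_pos h₁).ne'))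
  · rw [sub_self, smul_zero, add_zero] at hsum
    exact hne (sub_eq_zero.1 ((smul_eq_zero.1 hsum).resolve_left (one_sub_norm_sq_pos h₂).ne')).symm

theorem isOvular_numericalRange_rankTwoPartialIsometry (h₁ : ‖μ₁‖ < 1) (h₂ : ‖μ₂‖ < 1)
    (hneg : μ₁ ≠ -μ₂) (hne : μ₁ ≠ μ₂) :
    IsOvular (numericalRange (rankTwoPartialIsometry μ₁ μ₂)) where
  isCompact := isCompact_numericalRange _
  convex := convex_numericalRange _
  nonempty_interior :=
    nonempty_interior_numericalRange (not_hasReducingEigenvalue_rankTwoPartialIsometry h₁ h₂)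
  smooth :=
    hasSmoothBoundary_numericalRange (not_hasReducingEigenvalue_rankTwoPartialIsometry h₁ h₂)
  not_flat := not_hasFlatPortion_numericalRange fun _ hu t =>
    finrank_ker_supportPencil_rankTwoPartialIsometry_le_one h₁ h₂ hu t
  not_elliptical := not_isEllipticalDisk_numericalRange_rankTwoPartialIsometry h₁ h₂ hneg hne

end RankTwoPartialIsometry

theorem mainTheorem9 (μ₁ μ₂ : ℂ) (h₁ : ‖μ₁‖ < 1) (h₂ : ‖μ₂‖ < 1) :
    (μ₁ = -μ₂ → IsEllipticalDisk (numericalRange (rankTwoPartialIsometry μ₁ μ₂)) μ₁ μ₂) ∧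
    (μ₁ = μ₂ → IsEllipticalDisk (numericalRange (rankTwoPartialIsometry μ₁ μ₂)) 0 μ₁) ∧
    (μ₁ ≠ -μ₂ → μ₁ ≠ μ₂ → IsOvular (numericalRange (rankTwoPartialIsometry μ₁ μ₂))) := by
  refine ⟨?_, ?_, isOvular_numericalRange_rankTwoPartialIsometry h₁ h₂⟩
  · rintro rfl
    exact isEllipticalDisk_numericalRange_rankTwoPartialIsometry_neg h₂
  · rintro rfl
    exact isEllipticalDisk_numericalRange_rankTwoPartialIsometry_self h₁
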